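/- Let $b\ge 2$ be an integer and let $A=(a_n)_{n\ge 1}$ be a strictly increasing sequence of positive integers with $\limsup_{n\to\infty} a_{n+1}/a_n = 1$. Write $\|x\|$ for the distance from a real number $x$ to the nearest integer. For each irrational real number $\xi$ let $\hat v_{b,A}(\xi)$ be the supremum of the real numbers $\hat w\ge 0$ such that, for every sufficiently large integer $N$, there is an integer $n$ with $1\le n\le N$ and $\|b^{a_n}\xi\|<(b^{a_N})^{-\hat w}$. Then for every $\hat v\in[0,1]$ the sets $\{\xi\in\mathbb R\setminus\mathbb Q:\hat v_{b,A}(\xi)=\hat v\}$ and $\{\xi\in\mathbb R\setminus\mathbb Q:\hat v_{b,A}(\xi)\ge\hat v\}$ both have Hausdorff dimension $\left(\frac{1-\hat v}{1+\hat v}\right)^2$. -/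

import Mathlib

open Filter

noncomputable section

/-- The distance from a real number to the nearest integer. -/
def distNearestInt (x : ℝ) : ℝ := |x - (round x : ℝ)|

/-- The quantity `η = limsup a_{n+1} / a_n`, as an extended real number. -/
def limsupRatio (a : ℕ → ℕ) : EReal :=
  limsup (fun n : ℕ => (((a (n + 1) : ℝ) / (a n : ℝ) : ℝ) : EReal)) atTop

/-- The real numbers `v ≥ 0` such that, for every sufficiently large `N`, some index `n ≤ N`
satisfies `‖b ^ (a n) * ξ‖ < (b ^ (a N)) ^ (-v)`. The sequence is indexed from `0`. -/
def uniformExponentSet (b : ℕ) (a : ℕ → ℕ) (ξ : ℝ) : Set ℝ :=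
  {v : ℝ | 0 ≤ v ∧ ∀ᶠ N : ℕ in atTop, ∃ n ≤ N,
    distNearestInt ((b : ℝ) ^ (a n) * ξ) < ((b : ℝ) ^ (a N)) ^ (-v)}

/-- The uniform exponent of approximation of `ξ` (with respect to the denominators `b ^ (a n)`):
the supremum, in the extended real numbers, of `uniformExponentSet b a ξ`. -/
def uniformExponent (b : ℕ) (a : ℕ → ℕ) (ξ : ℝ) : EReal :=
  ⨆ v ∈ uniformExponentSet b a ξ, (v : EReal)

/-- The irrational numbers whose uniform exponent is at least `v`. -/
def uniformLevelGE (b : ℕ) (a : ℕ → ℕ) (v : ℝ) : Set ℝ :=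
  {ξ : ℝ | Irrational ξ ∧ (v : EReal) ≤ uniformExponent b a ξ}

/-- The irrational numbers whose uniform exponent is exactly `v`. -/
def uniformLevelEQ (b : ℕ) (a : ℕ → ℕ) (v : ℝ) : Set ℝ :=
  {ξ : ℝ | Irrational ξ ∧ uniformExponent b a ξ = (v : EReal)}

end

/-! Since `a (n + 1) / a n` tends to 1, approximation along `A` and along all powers of `b` have the
same uniform exponent, so it suffices to study `HasUniformRate`.

Upper bound. Let n_0 < n_1 < ... be the record minima of ‖b^m ξ‖. A rate u gives ‖b^{n_k} ξ‖ < b^{-u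
n_{k+1}}: about u n_{i+1} digits after position n_i are forced. Up to factors C^k there are b^{n_k -
u(n_1 + ... + n_k)} candidates for the nearest integer to b^{n_k} ξ, and each confines ξ to an
interval of radius b^{-(n_k + u n_{k+1})}. If the ratio of these exponents exceeded s for all large
k, the partial sums of n_k would satisfy a second-order recursive inequality whose discriminant is
negative when ((1-u)/(1+u))^2 < s < 1, which positive sums cannot do (`frequently_sub_sum_le`). The
covers summed over all possible prefixes converge, and a Cantelli argument concludes.

Lower bound. Put zeros on the blocks [r^k, (r-1) r^k) with r = 2/(1-v) and free digits elsewhere.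
The exponent is then at least v, and the free positions have lower density 1/(r-1)^2, the claimed
dimension. Inserting zeros has a Hölder inverse, so sets of smaller dimension have null preimage.
Points of exponent larger than v lie in countably many level sets of smaller dimension by the upper
bound, so almost every inserted point has exponent exactly v. -/

/-! ### Hausdorff–Cantelli covering bounds -/

open MeasureTheory Topology Set ENNReal NNReal in
theorem dimH_le_of_frequently_mem {X ι : Type*} [MetricSpace X] [Countable ι] {s : ℝ≥0} (hs : 0 < s)
    {E : Set X} (t : ι → Set X) (hsum : ∑' i, (Metric.ediam (t i)) ^ (s : ℝ) ≠ ∞)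
    (hE : ∀ x ∈ E, ∃ᶠ i in cofinite, x ∈ t i) : dimH E ≤ s := by
  borelize X
  have hs' : (0 : ℝ) < s := by exact_mod_cast hs
  apply dimH_le_of_hausdorffMeasure_ne_top
  have htail := ENNReal.tendsto_tsum_compl_atTop_zero hsum
  -- The covers are indexed by the finite set `F` of discarded sets; the tail to the power `1 / s`
  -- bounds every remaining diameter.
  have h := Measure.hausdorffMeasure_le_liminf_tsum (β := Finset ι) (ι := fun F => {i // i ∉ F})
    (s : ℝ) E (l := atTop)
    (fun F => (∑' i : {i // i ∉ F}, (Metric.ediam (t i)) ^ (s : ℝ)) ^ (1 / (s : ℝ)))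
    ?_ (fun F i => t i) ?_ ?_
  · rw [htail.liminf_eq] at h
    exact (lt_of_le_of_lt h (by simp)).ne
  · have := (ENNReal.continuous_rpow_const (y := 1 / (s : ℝ))).tendsto 0 |>.comp htail
    simpa [ENNReal.zero_rpow_of_pos (show (0 : ℝ) < (s : ℝ)⁻¹ by positivity), Function.comp_def]
      using this
  · refine Eventually.of_forall fun F i => ?_
    have h1 := ENNReal.le_tsum (f := fun i : {i // i ∉ F} => (Metric.ediam (t i)) ^ (s : ℝ)) i
    calc Metric.ediam (t i) = ((Metric.ediam (t i)) ^ (s : ℝ)) ^ (1 / (s : ℝ)) := by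
          rw [← ENNReal.rpow_mul, mul_one_div_cancel hs'.ne', ENNReal.rpow_one]
      _ ≤ _ := ENNReal.rpow_le_rpow h1 (by positivity)
  · refine Eventually.of_forall fun F x hx => ?_
    have h2 := hE x hx
    rw [Filter.frequently_cofinite_iff_infinite] at h2
    obtain ⟨i, hi, hiF⟩ := h2.exists_notMem_finset F
    exact mem_iUnion.2 ⟨⟨i, hiF⟩, hi⟩

open MeasureTheory Topology Set ENNReal NNReal in
theorem dimH_le_of_frequently_mem_closedBall {ι : Type*} [Countable ι] {s : ℝ≥0} (hs : 0 < s)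
    (P : ι → Finset ℤ) (c : ι → ℤ → ℝ) (r : ι → ℝ) (hr : ∀ i, 0 ≤ r i)
    (hsum : Summable fun i => ((P i).card : ℝ) * (2 * r i) ^ (s : ℝ)) {E : Set ℝ}
    (hE : ∀ x ∈ E, ∃ᶠ i in cofinite, ∃ p ∈ P i, |x - c i p| ≤ r i) : dimH E ≤ s := by
  refine dimH_le_of_frequently_mem (ι := Σ i, {p // p ∈ P i}) hs
    (fun j => Metric.closedBall (c j.1 j.2) (r j.1)) ?_ ?_
  · rw [ENNReal.tsum_sigma']
    refine ne_top_of_le_ne_top hsum.tsum_ofReal_ne_top ?_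
    refine ENNReal.tsum_le_tsum fun i => ?_
    rw [tsum_fintype]
    have : ∀ p : {p // p ∈ P i}, Metric.ediam (Metric.closedBall (c i p) (r i)) ^ (s : ℝ) ≤
        ENNReal.ofReal ((2 * r i) ^ (s : ℝ)) := by
      intro p
      have h2 := hr i
      rw [← ENNReal.ofReal_rpow_of_nonneg (by positivity) (by positivity)]
      refine ENNReal.rpow_le_rpow ?_ (by positivity)
      rw [Real.closedBall_eq_Icc, Real.ediam_Icc]
      apply ENNReal.ofReal_le_ofReal
      linarith
    refine (Finset.sum_le_sum fun p _ => this p).trans ?_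
    simp [ENNReal.ofReal_mul]
  · intro x hx
    have h1 := hE x hx
    rw [Filter.frequently_cofinite_iff_infinite] at h1 ⊢
    refine Set.Infinite.of_image Sigma.fst (h1.mono ?_)
    rintro i ⟨p, hp, hxp⟩
    exact ⟨⟨i, p, hp⟩, by simpa [Real.dist_eq] using hxp, rfl⟩

/-! ### The extremal growth inequality -/

/-- A recursion `t (k + 1) < A - B / t k` has no positive solution when `x ^ 2 - A x + B` has no
real root. -/
theorem not_forall_mul_lt_of_sq_lt (A B : ℝ) (h : A ^ 2 < 4 * B) (t : ℕ → ℝ) (ht : ∀ k, 0 < t k)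
    (hrec : ∀ k, t (k + 1) * t k < A * t k - B) : False := by
  -- `c` is the minimum of `x ^ 2 - A x + B`. Each step lowers `t` by at least `c / t k ≥ c / t 0`,
  -- so `t` eventually becomes negative.
  set c := B - A ^ 2 / 4 with hc
  have hc0 : 0 < c := by linarith
  have hstep : ∀ k, t (k + 1) * t k < t k * t k - c := fun k => by
    nlinarith [hrec k, sq_nonneg (t k - A / 2)]
  have hle : ∀ k, t (k + 1) ≤ t k := fun k => by
    by_contra! hlt
    nlinarith [hstep k, ht k]
  have hle0 : ∀ k, t k ≤ t 0 := fun k => antitone_nat_of_succ_le hle (Nat.zero_le k)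
  have hd : ∀ k, t (k + 1) ≤ t k - c / t 0 := fun k => by
    have h1 : t (k + 1) < t k - c / t k := by
      have := ht k
      rw [← mul_lt_mul_iff_left₀ this]
      have e : (t k - c / t k) * t k = t k * t k - c := by field_simp
      rw [e]; exact hstep k
    have h2 : c / t 0 ≤ c / t k := div_le_div_of_nonneg_left hc0.le (ht k) (hle0 k)
    linarith
  have hlin : ∀ k : ℕ, t k ≤ t 0 - k * (c / t 0) := fun k => by
    induction k with
    | zero => simp
    | succ k ih => push_cast; linarith [hd k]
  have hpos : 0 < c / t 0 := div_pos hc0 (ht 0)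
  obtain ⟨k, hk⟩ := exists_nat_gt (t 0 / (c / t 0))
  rw [div_lt_iff₀ hpos] at hk
  linarith [hlin k, ht k]

/-- The extremal growth estimate behind the value `((1 - u) / (1 + u)) ^ 2`. -/
theorem frequently_sub_sum_le (u s : ℝ) (hu : 0 < u)
    (hs : ((1 - u) / (1 + u)) ^ 2 < s) (n : ℕ → ℝ) (hn : ∀ k, 0 < n (k + 1)) :
    ∃ᶠ k in atTop, n k - u * ∑ i ∈ Finset.range k, n (i + 1) ≤ s * (n k + u * n (k + 1)) := by
  have hs0 : 0 < s := lt_of_le_of_lt (sq_nonneg _) hs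
  intro hev
  obtain ⟨K, hK⟩ := eventually_atTop.1 hev
  simp only [not_le] at hK
  -- The extra term in the range keeps `S 0` positive when `K = 0`.
  set S : ℕ → ℝ := fun k => ∑ i ∈ Finset.range (k + 1 + K), n (i + 1) with hS
  have hSpos : ∀ k, 0 < S k := fun k => Finset.sum_pos (fun i _ => hn i) ⟨0, by simp⟩
  have hS1 : ∀ k, S (k + 1) = S k + n (k + 2 + K) := fun k => by
    simp only [hS]
    rw [show k + 1 + 1 + K = (k + 1 + K) + 1 by ring, Finset.sum_range_succ]
  have key : ∀ k, s * u * S (k + 2) < (1 - s) * (1 - u) * S (k + 1) - (1 - s) * S k := fun k => by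
    have h1 := hK (k + 2 + K) (by omega)
    have e1 : ∑ i ∈ Finset.range (k + 2 + K), n (i + 1) = S (k + 1) := rfl
    have e2 := hS1 k
    have e3 := hS1 (k + 1)
    rw [e1] at h1
    rw [show k + 1 + 2 + K = k + 2 + K + 1 by ring] at e3
    have a1 : n (k + 2 + K) = S (k + 1) - S k := by linarith
    have a2 : n (k + 2 + K + 1) = S (k + 2) - S (k + 1) := by linarith
    rw [a1, a2] at h1
    nlinarith [h1]
  by_cases hs1 : 1 ≤ s
  · have h1 := hK (K + 1) (by omega)
    have h2 := hn K
    have h3 := hn (K + 1)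
    have h4 : 0 < ∑ i ∈ Finset.range (K + 1), n (i + 1) :=
      Finset.sum_pos (fun i _ => hn i) ⟨0, by simp⟩
    nlinarith [mul_pos hu h4, mul_pos hs0 (mul_pos hu h3),
      mul_nonneg (sub_nonneg.2 hs1) h2.le]
  push Not at hs1
  have hsu : 0 < s * u := mul_pos hs0 hu
  -- The discriminant condition reduces to `(1 - s) * (1 - u) ^ 2 < 4 * s * u`, that is `(1 - u) ^ 2
  -- < s * (1 + u) ^ 2`.
  refine not_forall_mul_lt_of_sq_lt ((1 - s) * (1 - u) / (s * u)) ((1 - s) / (s * u)) ?_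
    (fun k => S (k + 1) / S k) (fun k => div_pos (hSpos _) (hSpos _)) fun k => ?_
  · rw [div_pow, div_lt_iff₀ (by positivity)] at hs ⊢
    have e : 4 * ((1 - s) / (s * u)) * (s * u) ^ 2 = 4 * (1 - s) * (s * u) := by field_simp
    rw [e]
    have h1 : (1 - s) * (1 - u) ^ 2 < 4 * (s * u) := by nlinarith
    nlinarith
  · have h0 := hSpos k
    have h1 := hSpos (k + 1)
    have e : S (k + 1 + 1) / S (k + 1) * (S (k + 1) / S k) = S (k + 2) / S k := by field_simp
    show S (k + 1 + 1) / S (k + 1) * (S (k + 1) / S k) < _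
    rw [e, div_lt_iff₀ h0]
    have e2 : ((1 - s) * (1 - u) / (s * u) * (S (k + 1) / S k) - (1 - s) / (s * u)) * S k
      = ((1 - s) * (1 - u) * S (k + 1) - (1 - s) * S k) / (s * u) := by field_simp
    rw [e2, lt_div_iff₀ hsu]
    linarith [key k]

/-! ### Records of the distance to the nearest integer -/

/-- For all large `M`, some `m ≤ M` satisfies `‖b ^ m * ξ‖ < b ^ (-u * M)`. -/
def HasUniformRate (b : ℕ) (u ξ : ℝ) : Prop :=
  ∀ᶠ M : ℕ in atTop, ∃ m ≤ M, distNearestInt ((b : ℝ) ^ m * ξ) < (b : ℝ) ^ (-(u * M))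

theorem distNearestInt_le (x : ℝ) (z : ℤ) : distNearestInt x ≤ |x - z| := round_le x z

theorem distNearestInt_natCast_mul_le (n : ℕ) (x : ℝ) :
    distNearestInt (n * x) ≤ n * distNearestInt x := by
  have := distNearestInt_le (n * x) (n * round x)
  push_cast at this
  rwa [← mul_sub, abs_mul, Nat.abs_cast] at this

/-- Below 1/2 there is no wrap-around: `n * round x` is still the integer nearest to `n * x`. -/
theorem natCast_mul_le_distNearestInt (n : ℕ) (x : ℝ) (h : n * distNearestInt x < 1 / 2) :
    n * distNearestInt x ≤ distNearestInt (n * x) := by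
  have e : (n : ℝ) * distNearestInt x = |n * x - ((n * round x : ℤ) : ℝ)| := by
    push_cast
    rw [← mul_sub, abs_mul, Nat.abs_cast]; rfl
  rw [e] at h ⊢
  by_cases hz : round ((n : ℝ) * x) = n * round x
  · rw [← hz]; rfl
  · have h1 : (1 : ℝ) ≤ |((n * round x : ℤ) : ℝ) - (round ((n : ℝ) * x) : ℝ)| := by
      rw [← Int.cast_sub, ← Int.cast_abs]
      exact_mod_cast Int.one_le_abs (sub_ne_zero.2 (Ne.symm hz))
    have h2 := abs_sub_le ((n * round x : ℤ) : ℝ) (n * x) (round ((n : ℝ) * x) : ℝ)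
    rw [abs_sub_comm ((n * round x : ℤ) : ℝ) (n * x)] at h2
    unfold distNearestInt
    linarith

theorem distNearestInt_pos_of_irrational {x : ℝ} (h : Irrational x) : 0 < distNearestInt x :=
  abs_pos.2 (sub_ne_zero.2 (h.ne_int _))

/-- The next record is the least index with a value below the current one. Carrying the record
property in the subtype forces that index to be larger. -/
theorem exists_strictMono_records (δ : ℕ → ℝ) (hpos : ∀ m, 0 < δ m)
    (h : ∀ ε > 0, ∃ m, δ m < ε) :
    ∃ n : ℕ → ℕ, StrictMono n ∧ ∀ k, δ (n (k + 1)) < δ (n k) ∧ ∀ m < n (k + 1), δ (n k) ≤ δ m := by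
  classical
  have step : ∀ p : {n // ∀ m < n, δ n < δ m}, ∃ q : {n // ∀ m < n, δ n < δ m},
      p.1 < q.1 ∧ δ q.1 < δ p.1 ∧ ∀ m < q.1, δ p.1 ≤ δ m := by
    rintro ⟨n, hn⟩
    have hex := h (δ n) (hpos n)
    have hlow : ∀ m < Nat.find hex, δ n ≤ δ m := fun m hm => not_lt.1 (Nat.find_min hex hm)
    have hlt := Nat.find_spec hex
    refine ⟨⟨Nat.find hex, fun m hm => hlt.trans_le (hlow m hm)⟩, ?_, hlt, hlow⟩
    by_contra! hle
    rcases hle.lt_or_eq with h1 | h1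
    · exact absurd (hn _ h1) (not_lt.2 hlt.le)
    · change Nat.find hex = n at h1
      rw [h1] at hlt; exact lt_irrefl _ hlt
  choose next hnext using step
  let seq : ℕ → {n // ∀ m < n, δ n < δ m} := fun k => next^[k] ⟨0, by simp⟩
  have hseq : ∀ k, seq (k + 1) = next (seq k) := fun k => Function.iterate_succ_apply' _ _ _
  refine ⟨fun k => (seq k).1, strictMono_nat_of_lt_succ fun k => ?_, fun k => ?_⟩
  · rw [hseq]; exact (hnext _).1
  · simp only [hseq]; exact (hnext _).2

/-- The rate is applied just before the next record, where `n k` is still the minimiser. If the gap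
inequality failed, multiplying by `b ^ (n (k + 1) - n k)` would keep the distance below 1/2, so it
could not decrease, against the record property. -/
theorem exists_seq_of_hasUniformRate {b : ℕ} (hb : 2 ≤ b) {u u' ξ : ℝ} (hu : 0 < u) (huu : u < u')
    (hξ : Irrational ξ) (h : HasUniformRate b u' ξ) :
    ∃ n : ℕ → ℕ, StrictMono n ∧ ∀ k,
      distNearestInt ((b : ℝ) ^ n k * ξ) < (b : ℝ) ^ (-(u * n (k + 1))) ∧
      (n k : ℝ) + u * n (k + 1) ≤ n (k + 1) + 1 := by
  have hb1 : (1 : ℝ) < b := by exact_mod_cast hb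
  have hb0 : (0 : ℝ) < b := by linarith
  have hb2 : (2 : ℝ) ≤ b := by exact_mod_cast hb
  set δ : ℕ → ℝ := fun m => distNearestInt ((b : ℝ) ^ m * ξ) with hδ
  have hpos : ∀ m, 0 < δ m := fun m => distNearestInt_pos_of_irrational (by
    have := hξ.natCast_mul (m := b ^ m) (by positivity)
    simpa using this)
  obtain ⟨M₀, hM₀⟩ := eventually_atTop.1 h
  have hsmall : ∀ ε > 0, ∃ m, δ m < ε := fun ε hε => by
    have ht : Tendsto (fun M : ℕ => (b : ℝ) ^ (-(u' * M))) atTop (nhds 0) := by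
      have h1 : Tendsto (fun M : ℕ => u' * (M : ℝ)) atTop atTop :=
        tendsto_natCast_atTop_atTop.const_mul_atTop (hu.trans huu)
      have h2 := (tendsto_rpow_atBot_of_base_gt_one (b : ℝ) hb1).comp (tendsto_neg_atTop_atBot.comp h1)
      exact h2
    obtain ⟨M, hM, hM'⟩ := ((ht.eventually (gt_mem_nhds hε)).and h).exists
    obtain ⟨m, -, hm⟩ := hM'
    exact ⟨m, hm.trans hM⟩
  obtain ⟨n, hn, hrec⟩ := exists_strictMono_records δ hpos hsmall
  -- For `N ≥ u' / (u' - u)` one has `u' * (N - 1) ≥ u * N`, which absorbs the shift to `N - 1`.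
  obtain ⟨K, hK⟩ := exists_nat_ge (u' / (u' - u))
  set K' := max K M₀ with hK'
  refine ⟨fun k => n (k + K'), fun i j hij => hn (by omega), fun k => ?_⟩
  show δ (n (k + K')) < _ ∧ _
  have hkk : k + 1 + K' = (k + K') + 1 := by ring
  simp only [hkk]
  set N := n (k + K' + 1) with hN
  have hle : k + K' + 1 ≤ N := hn.le_apply
  have h1 : δ (n (k + K')) < (b : ℝ) ^ (-(u * N)) := by
    obtain ⟨m, hm, hm'⟩ := hM₀ (N - 1) (by omega)
    have h2 := (hrec (k + K')).2 m (by omega)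
    refine (h2.trans_lt hm').trans_le ?_
    apply Real.rpow_le_rpow_of_exponent_le hb1.le
    rw [div_le_iff₀ (by linarith)] at hK
    have h3 : (K : ℝ) ≤ N := by exact_mod_cast (by omega : K ≤ N)
    push_cast [Nat.cast_sub (by omega : 1 ≤ N)]
    nlinarith
  refine ⟨h1, ?_⟩
  by_contra! hcon
  have hlt : n (k + K') < N := hn (by omega)
  obtain ⟨j, hj⟩ : ∃ j, N = n (k + K') + j := ⟨N - n (k + K'), by omega⟩
  have h4 : ((b ^ j : ℕ) : ℝ) * δ (n (k + K')) < 1 / 2 := by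
    have hj' : (N : ℝ) = n (k + K') + j := by exact_mod_cast hj
    calc ((b ^ j : ℕ) : ℝ) * δ (n (k + K')) < (b : ℝ) ^ (j : ℝ) * (b : ℝ) ^ (-(u * N)) := by
          push_cast
          rw [Real.rpow_natCast]
          gcongr
      _ = (b : ℝ) ^ ((j : ℝ) - u * N) := by rw [← Real.rpow_add hb0]; congr 1
      _ ≤ (b : ℝ) ^ (-1 : ℝ) := Real.rpow_le_rpow_of_exponent_le hb1.le (by linarith)
      _ ≤ 1 / 2 := by
          rw [Real.rpow_neg_one, one_div]; gcongr
  have h5 := natCast_mul_le_distNearestInt (b ^ j) _ h4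
  have h6 : ((b ^ j : ℕ) : ℝ) * ((b : ℝ) ^ n (k + K') * ξ) = (b : ℝ) ^ N * ξ := by
    rw [hj]; push_cast; ring
  rw [h6] at h5
  have h7 := (hrec (k + K')).1
  have h8 : (1 : ℝ) ≤ ((b ^ j : ℕ) : ℝ) := by exact_mod_cast Nat.one_le_pow _ _ (by omega)
  have h9 := hpos (n (k + K'))
  have h10 : δ N < ((b ^ j : ℕ) : ℝ) * δ (n (k + K')) := by nlinarith
  exact absurd h10 (not_lt.2 h5)

/-! ### Counting prefixes and covering -/

theorem exists_finset_int_abs_sub_le (c R : ℝ) (hR : 0 ≤ R) :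
    ∃ P : Finset ℤ, (P.card : ℝ) ≤ 2 * R + 1 ∧ ∀ z : ℤ, |(z : ℝ) - c| ≤ R → z ∈ P := by
  refine ⟨Finset.Icc ⌈c - R⌉ ⌊c + R⌋, ?_, fun z hz => ?_⟩
  · rw [Int.card_Icc]
    have h1 := Int.le_ceil (c - R)
    have h2 := Int.floor_le (c + R)
    have h3 : ((⌊c + R⌋ + 1 - ⌈c - R⌉ : ℤ) : ℝ) ≤ 2 * R + 1 := by push_cast; linarith
    rcases le_total 0 (⌊c + R⌋ + 1 - ⌈c - R⌉) with h | h
    · have : (((⌊c + R⌋ + 1 - ⌈c - R⌉).toNat : ℕ) : ℝ) = ((⌊c + R⌋ + 1 - ⌈c - R⌉ : ℤ) : ℝ) := by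
        exact_mod_cast Int.toNat_of_nonneg h
      rw [this]; exact h3
    · rw [Int.toNat_of_nonpos h]; push_cast; linarith
  · rw [abs_le] at hz
    rw [Finset.mem_Icc, Int.ceil_le, Int.le_floor]
    constructor <;> linarith

/-- Given the nearest integer `p` at stage `k`, the next one is within `b ^ D + 1 / 2` of `b ^ (n (k
+ 1) - n k) * p`. The gap hypothesis gives `D ≥ -1`, so the factor `4 * b` absorbs the rounding. -/
theorem exists_finset_round_mem {b : ℕ} (hb : 2 ≤ b) (u : ℝ) (j : ℤ) (n : ℕ → ℕ)
    (hn : Monotone n) (k : ℕ) (h : ∀ i < k, (n i : ℝ) + u * n (i + 1) ≤ n (i + 1) + 1) :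
    ∃ P : Finset ℤ, (P.card : ℝ) ≤ (4 * b : ℝ) ^ (k + 1) *
        (b : ℝ) ^ ((n k : ℝ) - u * ∑ i ∈ Finset.range k, (n (i + 1) : ℝ)) ∧
      ∀ ξ : ℝ, ξ ∈ Set.Icc (j : ℝ) (j + 1) →
        (∀ i < k, distNearestInt ((b : ℝ) ^ n i * ξ) < (b : ℝ) ^ (-(u * n (i + 1)))) →
        round ((b : ℝ) ^ n k * ξ) ∈ P := by
  classical
  have hb1 : (1 : ℝ) < b := by exact_mod_cast hb
  have hb0 : (0 : ℝ) < b := by linarith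
  induction k with
  | zero =>
    obtain ⟨P, hP, hP'⟩ := exists_finset_int_abs_sub_le ((b : ℝ) ^ n 0 * (j + 1 / 2))
      ((b : ℝ) ^ n 0 / 2 + 1 / 2) (by positivity)
    refine ⟨P, hP.trans ?_, fun ξ hξ _ => hP' _ ?_⟩
    · have : (1 : ℝ) ≤ (b : ℝ) ^ n 0 := one_le_pow₀ hb1.le
      simp only [Finset.range_zero, Finset.sum_empty, mul_zero, sub_zero, zero_add, pow_one,
        Real.rpow_natCast]
      nlinarith
    · have h1 := abs_sub_round ((b : ℝ) ^ n 0 * ξ)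
      have h2 : |(b : ℝ) ^ n 0 * ξ - (b : ℝ) ^ n 0 * (j + 1 / 2)| ≤ (b : ℝ) ^ n 0 / 2 := by
        have h3 : |ξ - (j + 1 / 2)| ≤ 1 / 2 := by
          rw [abs_le]
          constructor <;> linarith [hξ.1, hξ.2]
        rw [← mul_sub, abs_mul, abs_of_pos (by positivity)]
        calc (b : ℝ) ^ n 0 * |ξ - (j + 1 / 2)| ≤ (b : ℝ) ^ n 0 * (1 / 2) := by gcongr
          _ = _ := by ring
      rw [abs_sub_comm] at h1
      have := abs_sub_le (round ((b : ℝ) ^ n 0 * ξ) : ℝ) ((b : ℝ) ^ n 0 * ξ)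
        ((b : ℝ) ^ n 0 * (j + 1 / 2))
      linarith
  | succ k ih =>
    obtain ⟨P, hP, hP'⟩ := ih fun i hi => h i (by omega)
    set D : ℝ := (n (k + 1) : ℝ) - n k - u * n (k + 1) with hD
    have hD1 : -1 ≤ D := by linarith [h k (by omega)]
    choose Q hQ hQ' using fun p : ℤ => exists_finset_int_abs_sub_le
      ((b : ℝ) ^ (n (k + 1) - n k) * p) ((b : ℝ) ^ D + 1 / 2) (by positivity)
    refine ⟨P.biUnion Q, ?_, fun ξ hξ hd => ?_⟩
    · have hQ2 : ∀ p, ((Q p).card : ℝ) ≤ 4 * b * (b : ℝ) ^ D := fun p => (hQ p).trans (by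
        have h1 : 1 ≤ (b : ℝ) * (b : ℝ) ^ D := by
          have : (b : ℝ) * (b : ℝ) ^ D = (b : ℝ) ^ (1 + D) := by
            rw [Real.rpow_add hb0, Real.rpow_one]
          rw [this]
          exact Real.one_le_rpow hb1.le (by linarith)
        have h2 : 0 < (b : ℝ) ^ D := by positivity
        nlinarith)
      calc ((P.biUnion Q).card : ℝ) ≤ ∑ p ∈ P, ((Q p).card : ℝ) := by
            exact_mod_cast Finset.card_biUnion_le
        _ ≤ ∑ p ∈ P, 4 * b * (b : ℝ) ^ D := Finset.sum_le_sum fun p _ => hQ2 p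
        _ = P.card * (4 * b * (b : ℝ) ^ D) := by simp
        _ ≤ (4 * b : ℝ) ^ (k + 1) *
            (b : ℝ) ^ ((n k : ℝ) - u * ∑ i ∈ Finset.range k, (n (i + 1) : ℝ)) *
            (4 * b * (b : ℝ) ^ D) := by gcongr
        _ = (4 * b : ℝ) ^ (k + 1 + 1) * ((b : ℝ) ^ ((n k : ℝ) -
            u * ∑ i ∈ Finset.range k, (n (i + 1) : ℝ)) * (b : ℝ) ^ D) := by ring
        _ = _ := by
            rw [← Real.rpow_add hb0, Finset.sum_range_succ]
            congr 2
            rw [hD]; ring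
    · rw [Finset.mem_biUnion]
      refine ⟨_, hP' ξ hξ fun i hi => hd i (by omega), hQ' _ _ ?_⟩
      have h1 := abs_sub_round ((b : ℝ) ^ n (k + 1) * ξ)
      have hnk : n k ≤ n (k + 1) := hn (by omega)
      have h2 : |(b : ℝ) ^ n (k + 1) * ξ - (b : ℝ) ^ (n (k + 1) - n k) *
          (round ((b : ℝ) ^ n k * ξ) : ℝ)| ≤ (b : ℝ) ^ D := by
        have e : (b : ℝ) ^ n (k + 1) * ξ = (b : ℝ) ^ (n (k + 1) - n k) * ((b : ℝ) ^ n k * ξ) := by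
          rw [← mul_assoc, ← pow_add, Nat.sub_add_cancel hnk]
        have e2 : (b : ℝ) ^ D = (b : ℝ) ^ (n (k + 1) - n k) * (b : ℝ) ^ (-(u * n (k + 1))) := by
          rw [← Real.rpow_natCast, ← Real.rpow_add hb0, Nat.cast_sub hnk, hD]
          congr 1
        rw [e, ← mul_sub, abs_mul, abs_of_pos (by positivity), e2]
        gcongr
        exact (hd k (by omega)).le
      rw [abs_sub_comm] at h1
      have := abs_sub_le (round ((b : ℝ) ^ n (k + 1) * ξ) : ℝ) ((b : ℝ) ^ n (k + 1) * ξ)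
        ((b : ℝ) ^ (n (k + 1) - n k) * (round ((b : ℝ) ^ n k * ξ) : ℝ))
      linarith

/-- This lets prefixes be indexed by finite subsets of ℕ, a countable family. -/
theorem StrictMono.eq_of_image_range_eq {n n' : ℕ → ℕ} (hn : StrictMono n) (hn' : StrictMono n')
    {k k' : ℕ} (h : (Finset.range k).image n = (Finset.range k').image n') :
    k = k' ∧ ∀ i < k, n i = n' i := by
  have hk : k = k' := by
    have := congrArg Finset.card h
    rwa [Finset.card_image_of_injective _ hn.injective,
      Finset.card_image_of_injective _ hn'.injective, Finset.card_range, Finset.card_range] at this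
  subst hk
  refine ⟨rfl, fun i hi => ?_⟩
  have hc : ((Finset.range k).image n).card = k := by
    rw [Finset.card_image_of_injective _ hn.injective, Finset.card_range]
  have h1 := Finset.orderEmbOfFin_unique hc (f := fun i : Fin k => n i)
    (fun x => Finset.mem_image_of_mem _ (by simp)) (fun x y hxy => hn hxy)
  have h2 := Finset.orderEmbOfFin_unique hc (f := fun i : Fin k => n' i)
    (fun x => by rw [h]; exact Finset.mem_image_of_mem _ (by simp)) (fun x y hxy => hn' hxy)
  exact congrFun (h1.trans h2.symm) ⟨i, hi⟩

/-- The gaps telescope. A gain exponential in the last term can therefore be shared among all terms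
of the prefix. -/
theorem sum_range_le_of_gap {u : ℝ} (hu : 0 < u) (hu1 : u ≤ 1) (n : ℕ → ℕ) (hn : StrictMono n)
    (k : ℕ) (h : ∀ i < k, (n i : ℝ) + u * n (i + 1) ≤ n (i + 1) + 1) :
    ∑ i ∈ Finset.range (k + 1), (n i : ℝ) ≤ 2 * n k / u := by
  have key : u * ∑ i ∈ Finset.range (k + 1), (n i : ℝ) ≤ n k + k := by
    induction k with
    | zero =>
      simp only [zero_add, Finset.sum_range_one, Nat.cast_zero, add_zero]
      have : (0 : ℝ) ≤ n 0 := by positivity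
      nlinarith
    | succ k ih =>
      rw [Finset.sum_range_succ, mul_add]
      push_cast
      linarith [ih fun i hi => h i (by omega), h k (by omega)]
  have h2 : (k : ℝ) ≤ n k := by exact_mod_cast hn.le_apply
  rw [le_div_iff₀ hu]
  linarith

/-- The initial segments `n 0 < ⋯ < n (k + 1)` that produce efficient coverings. -/
def IsEfficientPrefix (u s : ℝ) (n : ℕ → ℕ) (k : ℕ) : Prop :=
  StrictMono n ∧ (∀ i ≤ k, (n i : ℝ) + u * n (i + 1) ≤ n (i + 1) + 1) ∧
    (n k : ℝ) - u * ∑ i ∈ Finset.range k, (n (i + 1) : ℝ) ≤ s * (n k + u * n (k + 1))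

/-- The surplus `b ^ (-(s' - s) * Y)` is spread over the prefix. A bound that is a product over the
elements makes the sum over all prefixes tractable. -/
theorem exists_cover_of_isEfficientPrefix {b : ℕ} (hb : 2 ≤ b) {u s s' : ℝ} (hu : 0 < u)
    (hu1 : u ≤ 1) (hs : s < s') (j : ℤ) {n : ℕ → ℕ} {k : ℕ} (h : IsEfficientPrefix u s n k) :
    ∃ (P : Finset ℤ) (c : ℤ → ℝ) (r : ℝ), 0 ≤ r ∧
      (P.card : ℝ) * (2 * r) ^ s' ≤ 2 ^ s' * ∏ i ∈ (Finset.range (k + 2)).image n,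
        (4 * b * (b : ℝ) ^ (-((s' - s) * u ^ 2 / 2 * i))) ∧
      ∀ ξ ∈ Set.Icc (j : ℝ) (j + 1),
        (∀ i ≤ k, distNearestInt ((b : ℝ) ^ n i * ξ) < (b : ℝ) ^ (-(u * n (i + 1)))) →
        ∃ p ∈ P, |ξ - c p| ≤ r := by
  have hb1 : (1 : ℝ) < b := by exact_mod_cast hb
  have hb0 : (0 : ℝ) < b := by linarith
  obtain ⟨hn, hgap, heff⟩ := h
  obtain ⟨P, hP, hP'⟩ := exists_finset_round_mem hb u j n hn.monotone k fun i hi => hgap i hi.le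
  set Y : ℝ := n k + u * n (k + 1) with hY
  refine ⟨P, fun p => p / (b : ℝ) ^ n k, (b : ℝ) ^ (-Y), by positivity, ?_, fun ξ hξ hd => ?_⟩
  · rw [Finset.prod_image (fun x _ y _ hxy => hn.injective hxy), Finset.prod_mul_distrib,
      Finset.prod_const, Finset.card_range, ← Real.rpow_sum_of_pos hb0]
    have hsum := sum_range_le_of_gap hu hu1 n hn (k + 1) fun i hi => hgap i (by omega)
    have e1 : ∑ i ∈ Finset.range (k + 2), (-((s' - s) * u ^ 2 / 2 * (n i : ℝ))) =
        -((s' - s) * u ^ 2 / 2 * ∑ i ∈ Finset.range (k + 2), (n i : ℝ)) := by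
      rw [Finset.mul_sum, Finset.sum_neg_distrib]
    rw [e1]
    have e2 : -((s' - s) * Y) ≤ -((s' - s) * u ^ 2 / 2 * ∑ i ∈ Finset.range (k + 2), (n i : ℝ)) := by
      have h1 : (s' - s) * u ^ 2 / 2 * ∑ i ∈ Finset.range (k + 2), (n i : ℝ) ≤
          (s' - s) * u ^ 2 / 2 * (2 * n (k + 1) / u) := by
        have : 0 ≤ (s' - s) * u ^ 2 / 2 := by
          have := sub_pos.2 hs
          positivity
        exact mul_le_mul_of_nonneg_left hsum this
      have h2 : (s' - s) * u ^ 2 / 2 * (2 * n (k + 1) / u) = (s' - s) * (u * n (k + 1)) := by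
        field_simp
      have h3 : (0 : ℝ) ≤ n k := by positivity
      rw [h2] at h1
      have h4 : (s' - s) * (u * n (k + 1)) ≤ (s' - s) * Y :=
        mul_le_mul_of_nonneg_left (by linarith) (by linarith)
      linarith
    calc (P.card : ℝ) * (2 * (b : ℝ) ^ (-Y)) ^ s'
        = P.card * (2 ^ s' * (b : ℝ) ^ (-Y * s')) := by
          rw [Real.mul_rpow (by norm_num) (by positivity), ← Real.rpow_mul hb0.le]
      _ ≤ ((4 * b : ℝ) ^ (k + 1) * (b : ℝ) ^ (s * Y)) * (2 ^ s' * (b : ℝ) ^ (-Y * s')) := by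
          refine mul_le_mul_of_nonneg_right (hP.trans ?_) (by positivity)
          refine mul_le_mul_of_nonneg_left ?_ (by positivity)
          exact Real.rpow_le_rpow_of_exponent_le hb1.le heff
      _ = 2 ^ s' * ((4 * b : ℝ) ^ (k + 1) * (b : ℝ) ^ (-((s' - s) * Y))) := by
          have : (b : ℝ) ^ (-((s' - s) * Y)) = (b : ℝ) ^ (s * Y) * (b : ℝ) ^ (-Y * s') := by
            rw [← Real.rpow_add hb0]; congr 1; ring
          rw [this]; ring
      _ ≤ _ := by
          refine mul_le_mul_of_nonneg_left ?_ (by positivity)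
          refine mul_le_mul ?_ (Real.rpow_le_rpow_of_exponent_le hb1.le e2) (by positivity)
            (by positivity)
          exact pow_le_pow_right₀ (by linarith) (by omega)
  · refine ⟨_, hP' ξ hξ fun i hi => hd i hi.le, ?_⟩
    have h1 := hd k le_rfl
    have hp : (0 : ℝ) < (b : ℝ) ^ n k := by positivity
    have e : ξ - round ((b : ℝ) ^ n k * ξ) / (b : ℝ) ^ n k =
        ((b : ℝ) ^ n k * ξ - round ((b : ℝ) ^ n k * ξ)) / (b : ℝ) ^ n k := by
      field_simp
    rw [e, abs_div, abs_of_pos hp, div_le_iff₀ hp]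
    refine h1.le.trans (le_of_eq ?_)
    rw [← Real.rpow_natCast, ← Real.rpow_add hb0, hY]
    congr 1; ring

open NNReal in
theorem dimH_irrational_hasUniformRate_inter_Icc_le {b : ℕ} (hb : 2 ≤ b) {u u' s : ℝ} {s' : ℝ≥0}
    (hu : 0 < u) (hu1 : u ≤ 1) (huu : u < u') (hs : ((1 - u) / (1 + u)) ^ 2 < s) (hss : s < s')
    (j : ℤ) :
    dimH {ξ : ℝ | ξ ∈ Set.Icc (j : ℝ) (j + 1) ∧ Irrational ξ ∧ HasUniformRate b u' ξ} ≤ s' := by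
  classical
  have hb1 : (1 : ℝ) < b := by exact_mod_cast hb
  have hb0 : (0 : ℝ) < b := by linarith
  set x : ℕ → ℝ := fun i => 4 * b * (b : ℝ) ^ (-((s' - s) * u ^ 2 / 2 * i)) with hx
  have hx0 : ∀ i, 0 ≤ x i := fun i => by positivity
  have hxs : Summable x := by
    refine Summable.mul_left _ ?_
    have e : ∀ i : ℕ, (b : ℝ) ^ (-((s' - s) * u ^ 2 / 2 * i)) =
        ((b : ℝ) ^ (-((s' - s) * u ^ 2 / 2))) ^ i := fun i => by
      rw [← Real.rpow_mul_natCast hb0.le]; congr 1; ring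
    simp_rw [e]
    refine summable_geometric_of_lt_one (by positivity) ?_
    apply Real.rpow_lt_one_of_one_lt_of_neg hb1
    have := sub_pos.2 hss
    rw [neg_lt_zero]; positivity
  -- Sets that are no efficient prefix get the empty cover. The bounds then sum over all `F`, since
  -- the sum of `∏ i ∈ F, x i` is the convergent product of the `1 + x i`.
  have hcov : ∀ F : Finset ℕ, ∃ (P : Finset ℤ) (c : ℤ → ℝ) (r : ℝ), 0 ≤ r ∧
      (P.card : ℝ) * (2 * r) ^ (s' : ℝ) ≤ 2 ^ (s' : ℝ) * ∏ i ∈ F, x i ∧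
      ∀ n k, IsEfficientPrefix u s n k → F = (Finset.range (k + 2)).image n →
        ∀ ξ ∈ Set.Icc (j : ℝ) (j + 1),
        (∀ i ≤ k, distNearestInt ((b : ℝ) ^ n i * ξ) < (b : ℝ) ^ (-(u * n (i + 1)))) →
        ∃ p ∈ P, |ξ - c p| ≤ r := by
    intro F
    by_cases hF : ∃ n k, IsEfficientPrefix u s n k ∧ F = (Finset.range (k + 2)).image n
    · obtain ⟨n, k, hg, rfl⟩ := hF
      obtain ⟨P, c, r, hr, hw, hP⟩ := exists_cover_of_isEfficientPrefix hb hu hu1 hss j hg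
      refine ⟨P, c, r, hr, hw, fun n' k' hg' hF' ξ hξ hd => hP ξ hξ fun i hi => ?_⟩
      obtain ⟨hk, hnn⟩ := hg.1.eq_of_image_range_eq hg'.1 hF'
      rw [hnn i (by omega), hnn (i + 1) (by omega)]
      exact hd i (by omega)
    · refine ⟨∅, 0, 0, le_rfl, ?_, fun n k hg hF' => absurd ⟨n, k, hg, hF'⟩ hF⟩
      simpa using mul_nonneg (by positivity) (Finset.prod_nonneg fun i _ => hx0 i)
  choose P c r hr hw hP using hcov
  have hs0 : (0 : ℝ) < s' := (lt_of_le_of_lt (sq_nonneg _) hs).trans hss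
  refine dimH_le_of_frequently_mem_closedBall (by exact_mod_cast hs0) P c r hr ?_ ?_
  · refine Summable.of_nonneg_of_le (fun F => ?_) hw
      ((summable_finsetProd_of_summable_nonneg hx0 hxs).mul_left _)
    have := hr F
    positivity
  · rintro ξ ⟨hξj, hξ, hrate⟩
    obtain ⟨n, hn, hnk⟩ := exists_seq_of_hasUniformRate hb hu huu hξ hrate
    have hfreq := frequently_sub_sum_le u s hu hs (fun k => (n k : ℝ)) fun k => by
      have : 0 < n (k + 1) := (Nat.zero_le _).trans_lt (hn (Nat.lt_succ_self k))
      exact_mod_cast this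
    rw [Nat.frequently_atTop_iff_infinite] at hfreq
    rw [Filter.frequently_cofinite_iff_infinite]
    refine (hfreq.image (f := fun k => (Finset.range (k + 2)).image n) ?_).mono ?_
    · intro k _ k' _ hkk
      have := (hn.eq_of_image_range_eq hn hkk).1
      omega
    · rintro _ ⟨k, hk, rfl⟩
      exact hP _ n k ⟨hn, fun i _ => (hnk i).2, hk⟩ rfl ξ hξj fun i _ => (hnk i).1

theorem dimH_irrational_hasUniformRate_le {b : ℕ} (hb : 2 ≤ b) {u : ℝ} (hu : 0 < u)
    (hu1 : u ≤ 1) : dimH {ξ : ℝ | Irrational ξ ∧ HasUniformRate b u ξ} ≤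
      ENNReal.ofReal (((1 - u) / (1 + u)) ^ 2) := by
  have hsub : {ξ : ℝ | Irrational ξ ∧ HasUniformRate b u ξ} ⊆
      ⋃ j : ℤ, {ξ : ℝ | ξ ∈ Set.Icc (j : ℝ) (j + 1) ∧ Irrational ξ ∧ HasUniformRate b u ξ} :=
    fun ξ hξ => Set.mem_iUnion.2 ⟨⌊ξ⌋, ⟨Int.floor_le ξ, (Int.lt_floor_add_one ξ).le⟩, hξ⟩
  refine (dimH_mono hsub).trans ?_
  rw [dimH_iUnion]
  refine iSup_le fun j => ?_
  refine ENNReal.le_of_forall_pos_le_add fun ε hε _ => ?_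
  set A := ((1 - u) / (1 + u)) ^ 2 with hA
  have hA0 : 0 ≤ A := sq_nonneg _
  have hε' : (0 : ℝ) < ε := by exact_mod_cast hε
  have hcont : Tendsto (fun w : ℝ => ((1 - w) / (1 + w)) ^ 2) (nhdsWithin u (Set.Iio u)) (nhds A) := by
    have : ContinuousAt (fun w : ℝ => ((1 - w) / (1 + w)) ^ 2) u := by
      refine ContinuousAt.pow (ContinuousAt.div (by fun_prop) (by fun_prop) (by linarith)) 2
    exact this.tendsto.mono_left nhdsWithin_le_nhds
  obtain ⟨w, hw, hw0, hwu⟩ := ((hcont.eventually (gt_mem_nhds (show A < A + ε / 2 by linarith))).and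
    (Ioo_mem_nhdsLT hu)).exists
  have e : ENNReal.ofReal A + ε = ((A.toNNReal + ε : NNReal) : ENNReal) := by
    rw [ENNReal.coe_add]; rfl
  rw [e]
  refine dimH_irrational_hasUniformRate_inter_Icc_le hb hw0 (by linarith) hwu hw ?_ j
  rw [NNReal.coe_add, Real.coe_toNNReal _ hA0]
  linarith

/-! ### From the sequence `a` to all exponents and back -/

theorem eventually_lt_mul_of_limsupRatio {a : ℕ → ℕ} (ha_pos : ∀ n, 0 < a n)
    (hη : limsupRatio a = 1) {c : ℝ} (hc : 1 < c) :
    ∀ᶠ n in atTop, (a (n + 1) : ℝ) < c * a n := by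
  have h1 : limsupRatio a < (c : EReal) := by rw [hη]; exact_mod_cast hc
  filter_upwards [eventually_lt_of_limsup_lt h1] with n hn
  have h2 : (a (n + 1) : ℝ) / a n < c := by exact_mod_cast hn
  rwa [div_lt_iff₀ (by exact_mod_cast ha_pos n)] at h2

theorem StrictMono.exists_le_lt_succ {a : ℕ → ℕ} (ha : StrictMono a) {M N₀ : ℕ} (h : a N₀ ≤ M) :
    ∃ N, N₀ ≤ N ∧ a N ≤ M ∧ M < a (N + 1) := by
  refine ⟨Nat.findGreatest (fun N => a N ≤ M) M, ?_, ?_, ?_⟩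
  · exact Nat.le_findGreatest (ha.le_apply.trans h) h
  · exact Nat.findGreatest_spec (P := fun N => a N ≤ M) (ha.le_apply.trans h) h
  · by_contra! hle
    have := Nat.le_findGreatest (P := fun N => a N ≤ M) (ha.le_apply.trans hle) hle
    omega

theorem hasUniformRate_of_lt_uniformExponent {b : ℕ} (hb : 2 ≤ b) {a : ℕ → ℕ}
    (ha_pos : ∀ n, 0 < a n) (ha : StrictMono a) (hη : limsupRatio a = 1) {u ξ : ℝ} (hu : 0 < u)
    (h : (u : EReal) < uniformExponent b a ξ) : HasUniformRate b u ξ := by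
  have hb1 : (1 : ℝ) < b := by exact_mod_cast hb
  have hb0 : (0 : ℝ) < b := by linarith
  obtain ⟨w, hw⟩ := lt_iSup_iff.1 h
  obtain ⟨⟨hw0, hwN⟩, huw⟩ := lt_iSup_iff.1 hw
  have huw : u < w := by exact_mod_cast huw
  -- With ratio below `w / u`, the rate `w` at `a N` gives the rate `u` at every `M < a (N + 1)`.
  have hr := eventually_lt_mul_of_limsupRatio ha_pos hη (c := w / u) (by rwa [one_lt_div hu])
  obtain ⟨N₀, hN₀⟩ := eventually_atTop.1 (hr.and hwN)
  filter_upwards [eventually_ge_atTop (a N₀)] with M hM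
  obtain ⟨N, hN, hNM, hMN⟩ := ha.exists_le_lt_succ hM
  obtain ⟨h1, n, hn, hd⟩ := hN₀ N hN
  refine ⟨a n, (ha.monotone hn).trans hNM, hd.trans_le ?_⟩
  rw [← Real.rpow_natCast, ← Real.rpow_mul hb0.le]
  apply Real.rpow_le_rpow_of_exponent_le hb1.le
  have h2 : (M : ℝ) ≤ a (N + 1) := by exact_mod_cast hMN.le
  have h3 : u * (a (N + 1) : ℝ) < w * a N := by
    have := mul_lt_mul_of_pos_left h1 hu
    rwa [← mul_assoc, mul_div_cancel₀ _ hu.ne'] at this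
  nlinarith

/-- The additive constant makes the bound valid for every `n`: the index where it is used need not
be large. -/
theorem exists_forall_le_mul_add {a : ℕ → ℕ} (ha_pos : ∀ n, 0 < a n)
    (hη : limsupRatio a = 1) {c : ℝ} (hc : 1 < c) :
    ∃ C : ℝ, 0 ≤ C ∧ ∀ n, (a (n + 1) : ℝ) ≤ c * a n + C := by
  obtain ⟨N₀, hN₀⟩ := eventually_atTop.1 (eventually_lt_mul_of_limsupRatio ha_pos hη hc)
  refine ⟨∑ i ∈ Finset.range N₀, (a (i + 1) : ℝ), by positivity, fun n => ?_⟩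
  rcases lt_or_ge n N₀ with h | h
  · have := Finset.single_le_sum (f := fun i => (a (i + 1) : ℝ)) (fun i _ => by positivity)
      (Finset.mem_range.2 h)
    have h2 : 0 ≤ c * (a n : ℝ) := by positivity
    linarith
  · have h1 := hN₀ n h
    have : (0 : ℝ) ≤ ∑ i ∈ Finset.range N₀, (a (i + 1) : ℝ) := by positivity
    linarith

theorem le_uniformExponent_of_forall_hasUniformRate {b : ℕ} (hb : 2 ≤ b) {a : ℕ → ℕ}
    (ha_pos : ∀ n, 0 < a n) (ha : StrictMono a) (hη : limsupRatio a = 1) {v ξ : ℝ}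
    (h : ∀ u, 0 < u → u < v → HasUniformRate b u ξ) : (v : EReal) ≤ uniformExponent b a ξ := by
  have hb1 : (1 : ℝ) < b := by exact_mod_cast hb
  have hb0 : (0 : ℝ) < b := by linarith
  have hmem : ∀ u ∈ uniformExponentSet b a ξ, (u : EReal) ≤ uniformExponent b a ξ :=
    fun u hu => le_iSup₂_of_le u hu le_rfl
  have h0 : (0 : ℝ) ∈ uniformExponentSet b a ξ := by
    refine ⟨le_rfl, Eventually.of_forall fun N => ⟨N, le_rfl, ?_⟩⟩
    rw [neg_zero, Real.rpow_zero]
    exact (abs_sub_round _).trans_lt (by norm_num)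
  refine EReal.ge_of_forall_gt_iff_ge.1 fun u hu => ?_
  have hu : u < v := by exact_mod_cast hu
  rcases lt_or_ge u 0 with hneg | hu0
  · exact le_trans (by exact_mod_cast hneg.le) (hmem 0 h0)
  refine hmem u ⟨hu0, ?_⟩
  obtain ⟨w, huw, hwv⟩ := exists_between hu
  set ε := (w - u) / 2 with hε
  have hε0 : 0 < ε := by rw [hε]; linarith
  obtain ⟨C, hC0, hC⟩ := exists_forall_le_mul_add ha_pos hη (c := 1 + ε) (by linarith)
  have hlim : Tendsto (fun N => (a N : ℝ)) atTop atTop :=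
    tendsto_natCast_atTop_atTop.comp ha.tendsto_atTop
  have hrate := ha.tendsto_atTop.eventually (h w (by linarith) hwv)
  filter_upwards [hrate, hlim.eventually_ge_atTop ((C + a 0) / ε)] with N hN hNbig
  obtain ⟨m, hm, hd⟩ := hN
  rw [div_le_iff₀ hε0] at hNbig
  have hex : ∃ n, m ≤ a n := ⟨N, hm⟩
  classical
  -- Rounding `m` up to the next term of `a` multiplies the distance by at most `b ^ (2 * ε * a N)`,
  -- exactly the loss from `w` to `u`. The summand `a 0` in `hNbig` covers `n = 0`.
  obtain ⟨n, hnN, hmn, hlen⟩ : ∃ n ≤ N, m ≤ a n ∧ (a n : ℝ) ≤ m + 2 * ε * a N := by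
    refine ⟨Nat.find hex, Nat.find_min' hex hm, Nat.find_spec hex, ?_⟩
    have ha0 : (0 : ℝ) ≤ a 0 := by positivity
    have haN : (0 : ℝ) ≤ ε * a N := by positivity
    have hm0 : (0 : ℝ) ≤ m := by positivity
    rcases hn : Nat.find hex with _ | n
    · linarith
    · have h1 : a n < m := not_le.1 (Nat.find_min hex (by omega))
      have h1' : (a n : ℝ) ≤ m := by exact_mod_cast h1.le
      have h2 : (m : ℝ) ≤ a N := by exact_mod_cast hm
      have h3 := hC n
      nlinarith
  refine ⟨n, hnN, ?_⟩
  have e : (b : ℝ) ^ a n * ξ = ((b ^ (a n - m) : ℕ) : ℝ) * ((b : ℝ) ^ m * ξ) := by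
    push_cast
    rw [← mul_assoc, ← pow_add, Nat.sub_add_cancel hmn]
  rw [e]
  refine (distNearestInt_natCast_mul_le _ _).trans_lt ?_
  calc ((b ^ (a n - m) : ℕ) : ℝ) * distNearestInt ((b : ℝ) ^ m * ξ)
      < (b : ℝ) ^ ((a n : ℝ) - m) * (b : ℝ) ^ (-(w * a N)) := by
        rw [← Nat.cast_sub hmn, Real.rpow_natCast]
        push_cast
        gcongr
    _ = (b : ℝ) ^ ((a n : ℝ) - m - w * a N) := by rw [← Real.rpow_add hb0]; congr 1
    _ ≤ (b : ℝ) ^ ((a N : ℝ) * (-u)) := by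
        apply Real.rpow_le_rpow_of_exponent_le hb1.le
        have : 2 * ε = w - u := by rw [hε]; ring
        rw [this] at hlen
        nlinarith
    _ = _ := by rw [Real.rpow_mul hb0.le, Real.rpow_natCast]

theorem dimH_uniformLevelGE_le {b : ℕ} (hb : 2 ≤ b) {a : ℕ → ℕ} (ha_pos : ∀ n, 0 < a n)
    (ha : StrictMono a) (hη : limsupRatio a = 1) {v : ℝ} (hv : v ∈ Set.Icc (0 : ℝ) 1) :
    dimH (uniformLevelGE b a v) ≤ ENNReal.ofReal (((1 - v) / (1 + v)) ^ 2) := by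
  obtain ⟨hv0, hv1⟩ := hv
  rcases hv0.eq_or_lt with rfl | hvpos
  · refine (dimH_mono (Set.subset_univ _)).trans ?_
    rw [Real.dimH_univ]; simp
  have hcont : Tendsto (fun w : ℝ => ENNReal.ofReal (((1 - w) / (1 + w)) ^ 2))
      (nhdsWithin v (Set.Iio v)) (nhds (ENNReal.ofReal (((1 - v) / (1 + v)) ^ 2))) := by
    have : ContinuousAt (fun w : ℝ => ((1 - w) / (1 + w)) ^ 2) v := by
      refine ContinuousAt.pow (ContinuousAt.div (by fun_prop) (by fun_prop) (by linarith)) 2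
    exact (ENNReal.continuous_ofReal.tendsto _).comp (this.tendsto.mono_left nhdsWithin_le_nhds)
  refine ge_of_tendsto hcont ?_
  filter_upwards [Ioo_mem_nhdsLT hvpos] with w hw
  refine (dimH_mono ?_).trans (dimH_irrational_hasUniformRate_le hb hw.1 (hw.2.le.trans hv1))
  rintro ξ ⟨hξ, hle⟩
  refine ⟨hξ, hasUniformRate_of_lt_uniformExponent hb ha_pos ha hη hw.1 (lt_of_lt_of_le ?_ hle)⟩
  exact_mod_cast hw.2

/-! ### Inserting zero digits -/

section DigitInsertion

/-- Insert the last base-`b` digits of a natural number at the free positions below `n`, and zeros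
at the other positions below `n`. -/
def insertZeros (b : ℕ) (free : ℕ → Prop) [DecidablePred free] : ℕ → ℕ → ℕ
  | 0, p => p
  | n + 1, p => if free n then b * insertZeros b free n (p / b) + p % b
      else b * insertZeros b free n p

/-- The integer formed by the first `n` digits of `digitInsertion b free x`. -/
noncomputable def insertionApprox (b : ℕ) (free : ℕ → Prop) [DecidablePred free] (n : ℕ) (x : ℝ) : ℕ :=
  insertZeros b free n ⌊(b : ℝ) ^ Nat.count free n * x⌋₊

/-- The real number whose base-`b` digits are those of `x` at the free positions and zero
elsewhere. -/
noncomputable def digitInsertion (b : ℕ) (free : ℕ → Prop) [DecidablePred free] (x : ℝ) : ℝ :=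
  ⨆ n, (insertionApprox b free n x : ℝ) / (b : ℝ) ^ n

variable {b : ℕ} (free : ℕ → Prop) [DecidablePred free]

/-- Inserting zeros never shrinks a difference; the form avoids truncated subtraction. -/
theorem add_insertZeros_le (hb : 2 ≤ b) (n : ℕ) : ∀ p q : ℕ, p ≤ q →
    q + insertZeros b free n p ≤ p + insertZeros b free n q := by
  induction n with
  | zero => intro p q _; simp [insertZeros, add_comm]
  | succ n ih =>
    intro p q h
    by_cases hf : free n
    · simp only [insertZeros, hf, if_true]
      have h1 := Nat.mul_le_mul_left b (ih (p / b) (q / b) (Nat.div_le_div_right h))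
      have h2 := Nat.div_add_mod p b
      have h3 := Nat.div_add_mod q b
      rw [mul_add, mul_add] at h1
      omega
    · simp only [insertZeros, hf, if_false]
      have h1 := ih p q h
      nlinarith

/-- The first two facts nest the `b`-adic intervals at successive levels; the third is used on zero
blocks. -/
theorem insertionApprox_succ (hb : 2 ≤ b) (n : ℕ) (x : ℝ) :
    b * insertionApprox b free n x ≤ insertionApprox b free (n + 1) x ∧
    insertionApprox b free (n + 1) x + 1 ≤ b * (insertionApprox b free n x + 1) ∧
    (¬ free n → insertionApprox b free (n + 1) x = b * insertionApprox b free n x) := by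
  have hb0 : (b : ℝ) ≠ 0 := by positivity
  by_cases hf : free n
  · have e : ⌊(b : ℝ) ^ Nat.count free (n + 1) * x⌋₊ / b = ⌊(b : ℝ) ^ Nat.count free n * x⌋₊ := by
      rw [← Nat.floor_div_natCast, Nat.count_succ, if_pos hf]
      congr 1
      field_simp
      ring
    have hmod := Nat.mod_lt ⌊(b : ℝ) ^ Nat.count free (n + 1) * x⌋₊ (by omega : b > 0)
    have key : insertionApprox b free (n + 1) x = b * insertionApprox b free n x +
        ⌊(b : ℝ) ^ Nat.count free (n + 1) * x⌋₊ % b := by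
      unfold insertionApprox
      rw [insertZeros, if_pos hf, e]
    refine ⟨by omega, by rw [mul_add]; omega, fun h => absurd hf h⟩
  · have key : insertionApprox b free (n + 1) x = b * insertionApprox b free n x := by
      unfold insertionApprox
      rw [insertZeros, if_neg hf, Nat.count_succ, if_neg hf, add_zero]
    refine ⟨key.ge, by rw [key, mul_add]; omega, fun _ => key⟩

theorem monotone_insertionApprox_div (hb : 2 ≤ b) (x : ℝ) :
    Monotone fun n => (insertionApprox b free n x : ℝ) / (b : ℝ) ^ n := by
  refine monotone_nat_of_le_succ fun n => ?_
  have hb0 : (0 : ℝ) < b := by positivity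
  have h : (b : ℝ) * insertionApprox b free n x ≤ insertionApprox b free (n + 1) x := by
    exact_mod_cast (insertionApprox_succ free hb n x).1
  rw [div_le_div_iff₀ (by positivity) (by positivity), pow_succ]
  nlinarith [pow_pos hb0 n]

theorem antitone_insertionApprox_add_one_div (hb : 2 ≤ b) (x : ℝ) :
    Antitone fun n => ((insertionApprox b free n x : ℝ) + 1) / (b : ℝ) ^ n := by
  refine antitone_nat_of_succ_le fun n => ?_
  have hb0 : (0 : ℝ) < b := by positivity
  have h : (insertionApprox b free (n + 1) x : ℝ) + 1 ≤ b * (insertionApprox b free n x + 1) := by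
    exact_mod_cast (insertionApprox_succ free hb n x).2.1
  rw [div_le_div_iff₀ (by positivity) (by positivity), pow_succ]
  nlinarith [pow_pos hb0 n]

theorem insertionApprox_div_le_add_one_div (hb : 2 ≤ b) (x : ℝ) (n m : ℕ) :
    (insertionApprox b free n x : ℝ) / (b : ℝ) ^ n ≤
      ((insertionApprox b free m x : ℝ) + 1) / (b : ℝ) ^ m := by
  have hb0 : (0 : ℝ) < b := by positivity
  calc (insertionApprox b free n x : ℝ) / (b : ℝ) ^ n
      ≤ (insertionApprox b free (max n m) x : ℝ) / (b : ℝ) ^ (max n m) :=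
        monotone_insertionApprox_div free hb x (le_max_left _ _)
    _ ≤ ((insertionApprox b free (max n m) x : ℝ) + 1) / (b : ℝ) ^ (max n m) := by
        gcongr; linarith
    _ ≤ _ := antitone_insertionApprox_add_one_div free hb x (le_max_right _ _)

theorem insertionApprox_div_le_digitInsertion (hb : 2 ≤ b) (x : ℝ) (n : ℕ) :
    (insertionApprox b free n x : ℝ) / (b : ℝ) ^ n ≤ digitInsertion b free x :=
  le_ciSup (f := fun n => (insertionApprox b free n x : ℝ) / (b : ℝ) ^ n)
    ⟨_, Set.forall_mem_range.2 fun n => insertionApprox_div_le_add_one_div free hb x n 0⟩ n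

theorem digitInsertion_le (hb : 2 ≤ b) (x : ℝ) (n : ℕ) :
    digitInsertion b free x ≤ ((insertionApprox b free n x : ℝ) + 1) / (b : ℝ) ^ n :=
  ciSup_le fun m => insertionApprox_div_le_add_one_div free hb x m n

theorem distNearestInt_digitInsertion_le (hb : 2 ≤ b) (x : ℝ) {n m : ℕ} (hnm : n ≤ m)
    (h : ∀ i, n ≤ i → i < m → ¬ free i) :
    distNearestInt ((b : ℝ) ^ n * digitInsertion b free x) ≤ (b : ℝ) ^ ((n : ℝ) - m) := by
  have hb0 : (0 : ℝ) < b := by positivity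
  have key : ∀ k, n + k ≤ m →
      insertionApprox b free (n + k) x = b ^ k * insertionApprox b free n x := by
    intro k
    induction k with
    | zero => simp
    | succ k ih =>
      intro hk
      rw [← add_assoc, (insertionApprox_succ free hb (n + k) x).2.2 (h _ (by omega) (by omega)),
        ih (by omega), pow_succ]
      ring
  obtain ⟨k, rfl⟩ := Nat.exists_eq_add_of_le hnm
  have h1 := insertionApprox_div_le_digitInsertion free hb x n
  have h2 := digitInsertion_le free hb x (n + k)
  rw [key k le_rfl] at h2
  rw [div_le_iff₀ (by positivity)] at h1
  rw [le_div_iff₀ (by positivity)] at h2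
  have e : (b : ℝ) ^ ((n : ℝ) - (n + k : ℕ)) = 1 / (b : ℝ) ^ k := by
    push_cast
    rw [sub_add_cancel_left, Real.rpow_neg hb0.le, Real.rpow_natCast, one_div]
  refine (distNearestInt_le _ (insertionApprox b free n x : ℤ)).trans ?_
  rw [e]
  push_cast at h2 ⊢
  rw [abs_of_nonneg (by linarith), le_div_iff₀ (by positivity)]
  rw [pow_add] at h2
  linarith

/-- Of the 3 units, one is lost to the floors and one to the upper endpoint of the interval of `x`;
one remains. -/
theorem one_div_le_digitInsertion_sub (hb : 2 ≤ b) {x y : ℝ} (hx : 0 ≤ x) (hxy : x ≤ y) (n : ℕ)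
    (h : 3 ≤ (b : ℝ) ^ Nat.count free n * (y - x)) :
    1 / (b : ℝ) ^ n ≤ digitInsertion b free y - digitInsertion b free x := by
  have hb0 : (0 : ℝ) < b := by positivity
  have h1 := insertionApprox_div_le_digitInsertion free hb y n
  have h2 := digitInsertion_le free hb x n
  set B := (b : ℝ) ^ Nat.count free n with hB
  have hB0 : 0 < B := by positivity
  have h3 := add_insertZeros_le free hb n ⌊B * x⌋₊ ⌊B * y⌋₊
    (Nat.floor_mono (mul_le_mul_of_nonneg_left hxy hB0.le))
  have h3' : (⌊B * y⌋₊ : ℝ) + insertionApprox b free n x ≤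
    ⌊B * x⌋₊ + insertionApprox b free n y := by exact_mod_cast h3
  have h4 := Nat.floor_le (show 0 ≤ B * x by positivity)
  have h5 := Nat.lt_floor_add_one (B * y)
  have h6 : 1 / (b : ℝ) ^ n ≤ (insertionApprox b free n y : ℝ) / (b : ℝ) ^ n -
      ((insertionApprox b free n x : ℝ) + 1) / (b : ℝ) ^ n := by
    rw [← sub_div]
    gcongr
    linarith
  linarith

/-- At the first level `n` where `x` and `y` are separated by 3 units the images differ by `b ^
(-n)`. Level `n - 1` fails, which bounds `y - x` and costs the extra `b ^ s`. -/
theorem sub_le_mul_rpow_digitInsertion_sub (hb : 2 ≤ b) {s C : ℝ} (hs : 0 < s)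
    (hcount : ∀ n : ℕ, s * n - C ≤ Nat.count free n) {x y : ℝ} (hx : 0 ≤ x) (hxy : x < y)
    (hy : y < 1) :
    0 < digitInsertion b free y - digitInsertion b free x ∧
    y - x ≤ 3 * (b : ℝ) ^ (C + s) * (digitInsertion b free y - digitInsertion b free x) ^ s := by
  have hb1 : (1 : ℝ) < b := by exact_mod_cast hb
  have hb0 : (0 : ℝ) < b := by positivity
  have hex : ∃ n, 3 ≤ (b : ℝ) ^ Nat.count free n * (y - x) := by
    obtain ⟨k, hk⟩ := pow_unbounded_of_one_lt (3 / (y - x)) hb1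
    obtain ⟨n, hn⟩ := exists_nat_ge ((k + C) / s)
    refine ⟨n, ?_⟩
    rw [div_lt_iff₀ (by linarith)] at hk
    rw [div_le_iff₀ hs] at hn
    have h1 : k ≤ Nat.count free n := by
      have := hcount n
      have h2 : (k : ℝ) ≤ Nat.count free n := by linarith
      exact_mod_cast h2
    refine hk.le.trans (mul_le_mul_of_nonneg_right (pow_le_pow_right₀ hb1.le h1) (by linarith))
  classical
  have hspec := one_div_le_digitInsertion_sub free hb hx hxy.le _ (Nat.find_spec hex)
  have hmin := fun m => Nat.find_min hex (m := m)
  rcases hn : Nat.find hex with _ | k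
  · have := Nat.find_spec hex
    rw [hn, Nat.count_zero, pow_zero] at this
    linarith
  rw [hn] at hspec hmin
  have hk := hmin k (by omega)
  push Not at hk
  have hpos : 0 < 1 / (b : ℝ) ^ (k + 1) := by positivity
  refine ⟨hpos.trans_le hspec, ?_⟩
  calc y - x ≤ 3 / (b : ℝ) ^ Nat.count free k := by
        rw [le_div_iff₀ (by positivity)]; linarith
    _ = 3 * (b : ℝ) ^ (-(Nat.count free k : ℝ)) := by
        rw [Real.rpow_neg hb0.le, Real.rpow_natCast]; rfl
    _ ≤ 3 * (b : ℝ) ^ (C + s + (-((k + 1 : ℕ) : ℝ)) * s) := by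
        refine mul_le_mul_of_nonneg_left ?_ (by norm_num)
        apply Real.rpow_le_rpow_of_exponent_le hb1.le
        have := hcount k
        push_cast
        linarith
    _ = 3 * (b : ℝ) ^ (C + s) * (1 / (b : ℝ) ^ (k + 1)) ^ s := by
        rw [Real.rpow_add hb0, Real.rpow_mul hb0.le, Real.rpow_neg hb0.le, Real.rpow_natCast,
          one_div, mul_assoc]
    _ ≤ _ := by
        refine mul_le_mul_of_nonneg_left ?_ (by positivity)
        exact Real.rpow_le_rpow hpos.le hspec hs.le

-- The inverse is `s`-Hölder, so the preimage has dimension at most `dimH X / s < 1`.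
open MeasureTheory NNReal in
theorem volume_preimage_digitInsertion_eq_zero (hb : 2 ≤ b) {s : ℝ≥0} {C : ℝ} (hs : 0 < s)
    (hcount : ∀ n : ℕ, (s : ℝ) * n - C ≤ Nat.count free n) {X : Set ℝ} (hX : dimH X < s) :
    volume (Set.Ico (0 : ℝ) 1 ∩ digitInsertion b free ⁻¹' X) = 0 := by
  have hb0 : (0 : ℝ) < b := by positivity
  have hs' : (0 : ℝ) < s := by exact_mod_cast hs
  set f := digitInsertion b free with hf
  have hinj : Set.InjOn f (Set.Ico (0 : ℝ) 1) := by
    intro x hx y hy hxy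
    by_contra hne
    rcases lt_or_gt_of_ne hne with h | h
    · have := (sub_le_mul_rpow_digitInsertion_sub free hb hs' hcount hx.1 h hy.2).1
      linarith
    · have := (sub_le_mul_rpow_digitInsertion_sub free hb hs' hcount hy.1 h hx.2).1
      linarith
  set g := Function.invFunOn f (Set.Ico (0 : ℝ) 1) with hg
  have hgf : ∀ x ∈ Set.Ico (0 : ℝ) 1, g (f x) = x := fun x hx => hinj.leftInvOn_invFunOn hx
  have hhol : HolderOnWith (3 * (b : ℝ) ^ (C + s)).toNNReal s g (f '' Set.Ico (0 : ℝ) 1) := by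
    rintro _ ⟨x, hx, rfl⟩ _ ⟨y, hy, rfl⟩
    rw [hgf x hx, hgf y hy, edist_dist, edist_dist, ENNReal.ofReal_rpow_of_nonneg dist_nonneg hs'.le]
    change _ ≤ ENNReal.ofReal _ * _
    rw [← ENNReal.ofReal_mul (by positivity)]
    apply ENNReal.ofReal_le_ofReal
    have key : ∀ x ∈ Set.Ico (0 : ℝ) 1, ∀ y ∈ Set.Ico (0 : ℝ) 1, x < y →
        dist x y ≤ 3 * (b : ℝ) ^ (C + s) * dist (f x) (f y) ^ (s : ℝ) := by
      intro x hx y hy h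
      obtain ⟨h1, h2⟩ := sub_le_mul_rpow_digitInsertion_sub free hb hs' hcount hx.1 h hy.2
      rw [dist_comm, Real.dist_eq, abs_of_pos (sub_pos.2 h), dist_comm, Real.dist_eq, abs_of_pos h1]
      exact h2
    rcases lt_trichotomy x y with h | rfl | h
    · exact key x hx y hy h
    · rw [dist_self]; positivity
    · rw [dist_comm x, dist_comm (f x)]; exact key y hy x hx h
  set Y := Set.Ico (0 : ℝ) 1 ∩ f ⁻¹' X with hY
  have himg : g '' (f '' Y) = Y := by
    rw [Set.image_image]
    exact (Set.image_congr fun x hx => hgf x hx.1).trans (Set.image_id _)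
  have h1 := (hhol.mono (Set.image_mono (s := Y) Set.inter_subset_left)).dimH_image_le hs
  rw [himg] at h1
  have h2 : dimH Y < ((1 : ℝ≥0) : ENNReal) := by
    refine h1.trans_lt ?_
    have h3 : dimH (f '' Y) < s := (dimH_mono (by rintro _ ⟨x, hx, rfl⟩; exact hx.2)).trans_lt hX
    rw [ENNReal.div_lt_iff (Or.inl (by exact_mod_cast hs.ne')) (Or.inl ENNReal.coe_ne_top)]
    simpa using h3
  have h3 := hausdorffMeasure_of_dimH_lt h2
  rwa [NNReal.coe_one, hausdorffMeasure_real] at h3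

end DigitInsertion

/-! ### Zero blocks in geometric progression -/

/-- The positions outside the blocks `[r ^ k, (r - 1) r ^ k)`. -/
def IsFreePosition (r : ℝ) (i : ℕ) : Prop :=
  ¬ ∃ k : ℕ, r ^ k ≤ i ∧ (i : ℝ) < (r - 1) * r ^ k

theorem card_filter_between_le (n : ℕ) {x y : ℝ} (hxy : x ≤ min (n : ℝ) y) [DecidablePred
    fun i : ℕ => x ≤ i ∧ (i : ℝ) < y] :
    (((Finset.range n).filter fun i : ℕ => x ≤ i ∧ (i : ℝ) < y).card : ℝ) ≤
      min (n : ℝ) y - x + 1 := by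
  set R := (min (n : ℝ) y - x) / 2
  obtain ⟨P, hP, hP'⟩ := exists_finset_int_abs_sub_le (x + R) R (by
    have := sub_nonneg.2 hxy
    positivity)
  have h1 : (((Finset.range n).filter fun i : ℕ => x ≤ i ∧ (i : ℝ) < y).card) ≤ P.card := by
    refine Finset.card_le_card_of_injOn (fun i => (i : ℤ)) (fun i hi => ?_)
      (fun i _ j _ h => Int.ofNat_inj.1 h)
    simp only [Finset.coe_filter, Finset.mem_range, Set.mem_ofPred_eq] at hi
    obtain ⟨hin, hxi, hiy⟩ := hi
    have hin' : (i : ℝ) < n := by exact_mod_cast hin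
    have h3 : (i : ℝ) ≤ min (n : ℝ) y := le_min hin'.le hiy.le
    refine hP' _ ?_
    have hR : R * 2 = min (n : ℝ) y - x := div_mul_cancel₀ _ (by norm_num)
    push_cast
    rw [abs_le]
    constructor <;> linarith
  have h2 : (((Finset.range n).filter fun i : ℕ => x ≤ i ∧ (i : ℝ) < y).card : ℝ) ≤ P.card := by
    exact_mod_cast h1
  have hR : 2 * R = min (n : ℝ) y - x := mul_div_cancel₀ _ (by norm_num)
  linarith

-- The density of free positions is lowest at the end of a block, `n = (r - 1) * r ^ K`, where about
-- `r ^ K / (r - 1)` are free. Each block costs a rounding error of at most 1, whence `K + 1`.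
open Classical in
theorem le_count_isFreePosition {r : ℝ} (hr : 2 ≤ r) {n K : ℕ} (h1 : r ^ K ≤ n)
    (h2 : (n : ℝ) < r ^ (K + 1)) :
    (n : ℝ) / (r - 1) ^ 2 - (K + 1) ≤ Nat.count (IsFreePosition r) n := by
  have hr1 : 1 ≤ r - 1 := by linarith
  have hmono : ∀ {i j : ℕ}, i ≤ j → r ^ i ≤ r ^ j := fun h => pow_le_pow_right₀ (by linarith) h
  have hpos : ∀ i : ℕ, 0 < r ^ i := fun i => by positivity
  set m := min (n : ℝ) ((r - 1) * r ^ K) with hm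
  have hblock : (((Finset.range n).filter fun i => ¬ IsFreePosition r i).card : ℝ) ≤
      ∑ k ∈ Finset.range K, ((r - 2) * r ^ k + 1) + (m - r ^ K + 1) := by
    have hsub : ((Finset.range n).filter fun i => ¬ IsFreePosition r i) ⊆
        (Finset.range (K + 1)).biUnion fun k =>
          (Finset.range n).filter fun i : ℕ => r ^ k ≤ i ∧ (i : ℝ) < (r - 1) * r ^ k := by
      intro i hi
      rw [Finset.mem_filter, IsFreePosition, not_not] at hi
      obtain ⟨hin, k, hk⟩ := hi
      refine Finset.mem_biUnion.2 ⟨k, ?_, Finset.mem_filter.2 ⟨hin, hk⟩⟩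
      rw [Finset.mem_range] at hin ⊢
      by_contra! hK
      have h3 : (i : ℝ) < n := by exact_mod_cast hin
      linarith [hmono hK, hk.1]
    have hc : ∀ k ≤ K, (((Finset.range n).filter fun i : ℕ => r ^ k ≤ i ∧
        (i : ℝ) < (r - 1) * r ^ k).card : ℝ) ≤ min (n : ℝ) ((r - 1) * r ^ k) - r ^ k + 1 := by
      intro k hk
      refine card_filter_between_le n (le_min ((hmono hk).trans h1) ?_)
      exact le_mul_of_one_le_left (hpos k).le hr1
    calc (((Finset.range n).filter fun i => ¬ IsFreePosition r i).card : ℝ)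
        ≤ ∑ k ∈ Finset.range (K + 1), (((Finset.range n).filter fun i : ℕ => r ^ k ≤ i ∧
          (i : ℝ) < (r - 1) * r ^ k).card : ℝ) := by
          exact_mod_cast (Finset.card_le_card hsub).trans Finset.card_biUnion_le
      _ ≤ _ := by
          rw [Finset.sum_range_succ]
          refine add_le_add (Finset.sum_le_sum fun k hk => ?_) (hc K le_rfl)
          refine (hc k (Finset.mem_range.1 hk).le).trans ?_
          linarith [min_le_right (n : ℝ) ((r - 1) * r ^ k)]
  have hsum : (r - 1) * ∑ k ∈ Finset.range K, ((r - 2) * r ^ k + 1) =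
      (r - 2) * (r ^ K - 1) + (r - 1) * K := by
    rw [Finset.sum_add_distrib, ← Finset.mul_sum, ← mul_geom_sum r K]
    simp
    ring
  have hcount : (Nat.count (IsFreePosition r) n : ℝ) +
      ((Finset.range n).filter fun i => ¬ IsFreePosition r i).card = n := by
    rw [Nat.count_eq_card_filter_range]
    exact_mod_cast (Finset.card_filter_add_card_filter_not (s := Finset.range n) _).trans
      (Finset.card_range n)
  set T := ∑ k ∈ Finset.range K, ((r - 2) * r ^ k + 1) with hT
  have hT_le : T ≤ r ^ K - r ^ K / (r - 1) + K := by
    have hne : r - 1 ≠ 0 := by linarith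
    have e : (r - 1) * (r ^ K - r ^ K / (r - 1) + K) = (r - 2) * r ^ K + (r - 1) * K := by
      field_simp; ring
    nlinarith
  have hfinal : (n : ℝ) / (r - 1) ^ 2 ≤ n - m + r ^ K / (r - 1) := by
    have hsq : 1 ≤ (r - 1) ^ 2 := one_le_pow₀ hr1
    have hp : 0 < r - 1 := by linarith
    rw [div_le_iff₀ (by positivity)]
    have e : (n - m + r ^ K / (r - 1)) * (r - 1) ^ 2 = (n - m) * (r - 1) ^ 2 + r ^ K * (r - 1) := by
      field_simp
    rw [e]
    rcases le_total (n : ℝ) ((r - 1) * r ^ K) with h | h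
    · rw [hm, min_eq_left h]; linarith
    · rw [hm, min_eq_right h]; nlinarith
  linarith

open Classical in
theorem exists_forall_le_count_isFreePosition {r s : ℝ} (hr : 2 ≤ r)
    (hs : s < 1 / (r - 1) ^ 2) :
    ∃ C : ℝ, ∀ n : ℕ, s * n - C ≤ Nat.count (IsFreePosition r) n := by
  set ε := 1 / (r - 1) ^ 2 - s with hε
  have hε0 : 0 < ε := by linarith
  -- The error `K + 1` is logarithmic in `n`, since `2 ^ K ≤ r ^ K ≤ n`.
  obtain ⟨C, hC⟩ : ∃ C : ℝ, ∀ K : ℕ, (K : ℝ) + 1 ≤ ε * 2 ^ K + C := by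
    have ht := tendsto_pow_const_div_const_pow_of_one_lt 1 (show (1 : ℝ) < 2 by norm_num)
    obtain ⟨K₀, hK₀⟩ := eventually_atTop.1 (ht.eventually (gt_mem_nhds hε0))
    refine ⟨K₀ + 1, fun K => ?_⟩
    rcases lt_or_ge K K₀ with h | h
    · have h3 : (K : ℝ) ≤ K₀ := by exact_mod_cast h.le
      have : 0 < ε * 2 ^ K := by positivity
      linarith
    · have h3 := hK₀ K h
      rw [pow_one, div_lt_iff₀ (by positivity)] at h3
      have : (0 : ℝ) ≤ K₀ := by positivity
      linarith
  refine ⟨max C 0, fun n => ?_⟩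
  rcases Nat.eq_zero_or_pos n with rfl | hn
  · simp
  obtain ⟨K, hK1, hK2⟩ := exists_nat_pow_near (x := (n : ℝ)) (y := r) (by exact_mod_cast hn)
    (by linarith)
  have h1 := le_count_isFreePosition hr hK1 hK2
  have h2 : (2 : ℝ) ^ K ≤ n := (pow_le_pow_left₀ (by norm_num) hr K).trans hK1
  have h3 := hC K
  have h4 : ε * 2 ^ K ≤ ε * n := mul_le_mul_of_nonneg_left h2 hε0.le
  have h5 : (n : ℝ) / (r - 1) ^ 2 = s * n + ε * n := by rw [hε]; ring
  linarith [le_max_left C 0]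

-- For `r ^ K ≤ M < r ^ (K + 1)` the block starting at `r ^ K` has length `(r - 2) * r ^ K > (r - 2)
-- / r * M` up to rounding when `r > 2`; the strict inequality on `u` absorbs the ceilings.
open Classical in
theorem hasUniformRate_digitInsertion {b : ℕ} (hb : 2 ≤ b) {r u : ℝ} (hr : 2 ≤ r)
    (hu : u < (r - 2) / r) (x : ℝ) :
    HasUniformRate b u (digitInsertion b (IsFreePosition r) x) := by
  have hb1 : (1 : ℝ) < b := by exact_mod_cast hb
  have hlim : Tendsto (fun M : ℕ => (M : ℝ)) atTop atTop := tendsto_natCast_atTop_atTop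
  have hd : 0 < (r - 2) / r - u := by linarith
  filter_upwards [hlim.eventually_gt_atTop (1 / ((r - 2) / r - u)), eventually_ge_atTop 1]
    with M hM hM1
  rw [div_lt_iff₀ hd] at hM
  obtain ⟨K, hK1, hK2⟩ := exists_nat_pow_near (x := (M : ℝ)) (y := r) (by exact_mod_cast hM1)
    (by linarith)
  have hpos : 0 < r ^ K := by positivity
  refine ⟨⌈r ^ K⌉₊, Nat.ceil_le.2 hK1, ?_⟩
  refine (distNearestInt_digitInsertion_le (IsFreePosition r) hb x (m := ⌈(r - 1) * r ^ K⌉₊)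
    (Nat.ceil_mono (le_mul_of_one_le_left hpos.le (by linarith)))
    fun i hi hi' => not_not.2 ⟨K, Nat.ceil_le.1 hi, Nat.lt_ceil.1 hi'⟩).trans_lt ?_
  apply Real.rpow_lt_rpow_of_exponent_lt hb1
  have h1 := Nat.ceil_lt_add_one hpos.le
  have h2 := Nat.le_ceil ((r - 1) * r ^ K)
  have h3 : (r - 2) / r * M ≤ (r - 2) * r ^ K := by
    calc (r - 2) / r * M ≤ (r - 2) / r * r ^ (K + 1) := by
          refine mul_le_mul_of_nonneg_left hK2.le (div_nonneg (by linarith) (by linarith))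
      _ = _ := by
          have : r ≠ 0 := by linarith
          field_simp
          ring
  nlinarith

/-! ### The lower bound and the conclusion -/

open MeasureTheory NNReal in
open Classical in
theorem le_dimH_uniformLevelEQ {b : ℕ} (hb : 2 ≤ b) {a : ℕ → ℕ} (ha_pos : ∀ n, 0 < a n)
    (ha : StrictMono a) (hη : limsupRatio a = 1) {v : ℝ} (hv : v ∈ Set.Ico (0 : ℝ) 1) :
    ENNReal.ofReal (((1 - v) / (1 + v)) ^ 2) ≤ dimH (uniformLevelEQ b a v) := by
  obtain ⟨hv0, hv1⟩ := hv
  have hv1' : 0 < 1 - v := by linarith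
  -- The solution of `(r - 2) / r = v`.
  set r := 2 / (1 - v) with hr
  have hr2 : 2 ≤ r := by rw [hr, le_div_iff₀ hv1']; linarith
  have hrv : (r - 2) / r = v := by rw [hr]; field_simp; ring
  have hrs : 1 / (r - 1) ^ 2 = ((1 - v) / (1 + v)) ^ 2 := by
    have : r - 1 = (1 + v) / (1 - v) := by rw [hr]; field_simp; ring
    rw [this, ← one_div_pow, one_div_div]
  set A := ((1 - v) / (1 + v)) ^ 2 with hA
  set f := digitInsertion b (IsFreePosition r) with hf
  have hnull : ∀ X : Set ℝ, dimH X < ENNReal.ofReal A →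
      volume (Set.Ico (0 : ℝ) 1 ∩ f ⁻¹' X) = 0 := by
    intro X hX
    obtain ⟨s, hXs, hsA⟩ := ENNReal.lt_iff_exists_nnreal_btwn.1 hX
    have hs : 0 < s := ENNReal.coe_pos.1 (bot_le.trans_lt hXs)
    have hsA' : (s : ℝ) < A := by
      rw [← ENNReal.ofReal_coe_nnreal] at hsA
      exact (ENNReal.ofReal_lt_ofReal_iff_of_nonneg s.2).1 hsA
    obtain ⟨C, hC⟩ := exists_forall_le_count_isFreePosition hr2 (hsA'.trans_eq hrs.symm)
    exact volume_preimage_digitInsertion_eq_zero _ hb hs hC hXs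
  by_contra! hcon
  -- Levels decreasing to `v`; the shift by 2 keeps them below 1, where the upper bound applies.
  set w : ℕ → ℝ := fun n => v + (1 - v) / (n + 2) with hw
  have hwmem : ∀ n, v < w n ∧ w n < 1 := fun n => by
    have h1 : 0 < (1 - v) / ((n : ℝ) + 2) := by positivity
    have h2 : (1 - v) / ((n : ℝ) + 2) < 1 - v := by
      apply div_lt_self hv1'
      have : (0 : ℝ) ≤ n := by positivity
      linarith
    constructor <;> simp only [hw] <;> linarith
  have hcover : Set.Ico (0 : ℝ) 1 ⊆ (Set.Ico (0 : ℝ) 1 ∩ f ⁻¹' Set.range ((↑) : ℚ → ℝ)) ∪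
      (Set.Ico (0 : ℝ) 1 ∩ f ⁻¹' uniformLevelEQ b a v) ∪
      ⋃ n, Set.Ico (0 : ℝ) 1 ∩ f ⁻¹' uniformLevelGE b a (w n) := by
    intro x hx
    by_cases hirr : Irrational (f x)
    · have hge : (v : EReal) ≤ uniformExponent b a (f x) :=
        le_uniformExponent_of_forall_hasUniformRate hb ha_pos ha hη fun u _ huv =>
          hasUniformRate_digitInsertion hb hr2 (huv.trans_eq hrv.symm) x
      rcases hge.eq_or_lt with heq | hlt
      · exact Or.inl (Or.inr ⟨hx, hirr, heq.symm⟩)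
      · obtain ⟨z, hvz, hz⟩ := EReal.lt_iff_exists_real_btwn.1 hlt
        have hvz : v < z := by exact_mod_cast hvz
        obtain ⟨n, hn⟩ := exists_nat_gt ((1 - v) / (z - v))
        rw [div_lt_iff₀ (by linarith)] at hn
        refine Or.inr (Set.mem_iUnion.2 ⟨n, hx, hirr, le_trans ?_ hz.le⟩)
        have : w n ≤ z := by
          have h1 : (1 - v) / ((n : ℝ) + 2) ≤ z - v := by
            rw [div_le_iff₀ (by positivity)]; nlinarith
          simp only [hw]; linarith
        exact_mod_cast this
    · exact Or.inl (Or.inl ⟨hx, not_not.1 hirr⟩)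
  have hA0 : 0 < A := by rw [hA]; have : 0 < 1 + v := by linarith
                         positivity
  have hzero : volume (Set.Ico (0 : ℝ) 1) = 0 := by
    refine measure_mono_null hcover (measure_union_null (measure_union_null (hnull _ ?_)
      (hnull _ hcon)) (measure_iUnion_null fun n => hnull _ ?_))
    · rw [dimH_countable (Set.countable_range _)]
      exact ENNReal.ofReal_pos.2 hA0
    · obtain ⟨h1, h2⟩ := hwmem n
      refine (dimH_uniformLevelGE_le hb ha_pos ha hη ⟨by linarith, h2.le⟩).trans_lt ?_
      rw [ENNReal.ofReal_lt_ofReal_iff hA0, hA]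
      refine pow_lt_pow_left₀ ?_ (div_nonneg (by linarith) (by linarith)) (by norm_num)
      rw [div_lt_div_iff₀ (by linarith) (by linarith)]
      nlinarith
  rw [Real.volume_Ico] at hzero
  norm_num at hzero

theorem theorem11 (b : ℕ) (hb : 2 ≤ b) (a : ℕ → ℕ) (ha_pos : ∀ n, 0 < a n)
    (ha : StrictMono a) (hη : limsupRatio a = 1) (v : ℝ) (hv : v ∈ Set.Icc (0 : ℝ) 1) :
    dimH (uniformLevelEQ b a v) = ENNReal.ofReal (((1 - v) / (1 + v)) ^ 2) ∧
    dimH (uniformLevelGE b a v) = ENNReal.ofReal (((1 - v) / (1 + v)) ^ 2) := by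
  have hsub : uniformLevelEQ b a v ⊆ uniformLevelGE b a v := fun ξ hξ => ⟨hξ.1, hξ.2.ge⟩
  have hupper := dimH_uniformLevelGE_le hb ha_pos ha hη hv
  have hlower : ENNReal.ofReal (((1 - v) / (1 + v)) ^ 2) ≤ dimH (uniformLevelEQ b a v) := by
    rcases hv.2.eq_or_lt with rfl | h1
    · simp
    · exact le_dimH_uniformLevelEQ hb ha_pos ha hη ⟨hv.1, h1⟩
  have hmono := dimH_mono hsub
  exact ⟨le_antisymm (hmono.trans hupper) hlower, le_antisymm hupper (hlower.trans hmono)⟩
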